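/- Let $p$ be a prime. For $a\in\mathbb N=\{1,2,\dots\}$ put $A_a=\begin{pmatrix}0&1\\1&a\end{pmatrix}$, and for a finite word $u=a_1\dots a_n$ put $A_u=A_{a_1}\cdots A_{a_n}$ (the identity for the empty word). For $N\in\mathbb N$ let $\mathcal A_N=\{1,\dots,N\}$. For an infinite word $w=a_1a_2a_3\dots$ let $w_n=a_1\dots a_n$ ($n\ge 0$) denote its prefixes and $\mathrm Tw=a_2a_3\dots$ its shift. The word $w$ is recurrent if every finite block occurring in $w$ occurs in it infinitely often, and periodic if $\mathrm T^l w=w$ for some $l\ge 1$. For $k\in\mathbb N$ let $$U_k(w)=\{A_{w_n} \bmod p^k : n\ge 0\},\qquad \mathbf U_k=\{U_k(\mathrm T^m w) : m\ge 0\}.$$ For $\epsilon>0$ let $\mathbf{PBad}_\epsilon$ be the set of points $\mathbf q=(q_1:q_2)$ of the projective line $\mathbf P^1_{\mathbb Q_p}$ such that for all $(a,b)\in\mathbb Z^2\setminus\{(0,0)\}$ $$|aq_1+bq_2|_p\cdot\min\{|q_1|_p^{-1},|q_2|_p^{-1}\}\ \ge\ \epsilon\cdot\min\{|a|^{-2},|b|^{-2}\},$$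 where the inverse of $0$ is read as $+\infty$. Extend the shift to pairs by $\mathrm T(w,\mathbf q)=(\mathrm Tw,A_{a_1}\mathbf q)$, where $a_1$ is the first letter of $w$. Let $\mathbf{LMad}$ be the set of pairs $(w,\mathbf x_p)$ for which there is an $\epsilon>0$ such that, with $N_\epsilon=\lfloor\epsilon^{-1}\rfloor+1$, one has $\mathrm T^n(w,\mathbf x_p)\in\mathcal A_{N_\epsilon}^{\mathbb N}\times\mathbf{PBad}_\epsilon$ for every $n\ge 0$. **Proposition.** Let $N\in\mathbb N$ and let $w\in\mathcal A_N^{\mathbb N}$ be recurrent. Suppose that there is a constant $C$ with $\#\mathbf U_k\le C$ for every $k\in\mathbb N$. Then there are at most two points $\mathbf x_p\in\mathbf P^1_{\mathbb Q_p}$ such that $(w,\mathbf x_p)\in\mathbf{LMad}$. If moreover $w$ is not periodic, then $(w,\mathbf x_p)\notin\mathbf{LMad}$ for every $\mathbf x_p\in\mathbf P^1_{\mathbb Q_p}$. -/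

import Mathlib

open scoped LinearAlgebra.Projectivization MatrixGroups

namespace LimitMad

/-! Infinite words over `ℕ` are functions `w : ℕ → ℕ`; the first letter is `w 0`. -/

/-- The alphabet `{1, ..., N}`. -/
def alphabet (N : ℕ) : Set ℕ := Set.Icc 1 N

/-- The left shift on infinite words. -/
def shift (w : ℕ → ℕ) : ℕ → ℕ := fun i => w (i + 1)

/-- The prefix of length `n` of an infinite word. -/
def prefixWord (w : ℕ → ℕ) (n : ℕ) : List ℕ := (List.range n).map w

/-- Every finite block which occurs in `w` occurs in `w` infinitely often. -/
def IsRecurrent (w : ℕ → ℕ) : Prop :=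
  ∀ u : List ℕ, (∃ n, prefixWord (shift^[n] w) u.length = u) →
    {n | prefixWord (shift^[n] w) u.length = u}.Infinite

/-- `w = T^l w` for some positive `l`. -/
def IsPeriodic (w : ℕ → ℕ) : Prop := ∃ l, 0 < l ∧ shift^[l] w = w

/-- The matrix `(0 1; 1 a)` of determinant `-1`. Note that `GL(2, ℤ)` is the group of integer
matrices of determinant `1` or `-1`. -/
def letterMatrix (a : ℕ) : GL (Fin 2) ℤ :=
  ⟨!![0, 1; 1, (a : ℤ)], !![-(a : ℤ), 1; 1, 0],
    by simp [Matrix.one_fin_two], by simp [Matrix.one_fin_two]⟩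

/-- The product of the letter matrices along a finite word (from left to right). -/
def wordMatrix (u : List ℕ) : GL (Fin 2) ℤ := (u.map letterMatrix).prod

/-- Reduction of integer matrices modulo `p ^ k`. -/
def reduction (p k : ℕ) : GL (Fin 2) ℤ →* GL (Fin 2) (ZMod (p ^ k)) :=
  Matrix.GeneralLinearGroup.map (Int.castRingHom (ZMod (p ^ k)))

/-- `U_k(w)`: the matrices of all the prefixes of `w` (the empty one included) modulo `p ^ k`. -/
def prefixResidues (p k : ℕ) (w : ℕ → ℕ) : Set (GL (Fin 2) (ZMod (p ^ k))) :=
  Set.range fun n : ℕ => reduction p k (wordMatrix (prefixWord w n))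

/-- The collection of the distinct sets among `U_k(T^m w)`, `m ≥ 0`. -/
def residueCollection (p k : ℕ) (w : ℕ → ℕ) : Set (Set (GL (Fin 2) (ZMod (p ^ k)))) :=
  Set.range fun m : ℕ => prefixResidues p k (shift^[m] w)

variable (p : ℕ) [Fact p.Prime]

/-- The extended shift `T(w, q) = (T w, A_{w 0} q)` on pairs (infinite word, point of the
projective line over `ℚ_p`). -/
noncomputable def extShift (x : (ℕ → ℕ) × ℙ ℚ_[p] (Fin 2 → ℚ_[p])) :
    (ℕ → ℕ) × ℙ ℚ_[p] (Fin 2 → ℚ_[p]) :=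
  (shift x.1,
    Matrix.GeneralLinearGroup.map (Int.castRingHom ℚ_[p]) (letterMatrix (x.1 0)) • x.2)

/-- The points `(q₁ : q₂)` with
`|a q₁ + b q₂| * min (|q₁|⁻¹, |q₂|⁻¹) ≥ min (|a|⁻², |b|⁻²) * ε` for all integers `(a, b) ≠ (0, 0)`,
where the inverse of zero counts as infinity, so that the minimum of the two inverses is the
inverse of the maximum. The condition is homogeneous in `(q₁, q₂)`, see `mk_mem_pBad`. -/
def pBad (ε : ℝ) : Set (ℙ ℚ_[p] (Fin 2 → ℚ_[p])) :=
  {q | ∀ a b : ℤ, (a, b) ≠ (0, 0) →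
    (max (|(a : ℝ)| ^ 2) (|(b : ℝ)| ^ 2))⁻¹ * ε ≤
      ‖(a : ℚ_[p]) * q.rep 0 + (b : ℚ_[p]) * q.rep 1‖ * (max ‖q.rep 0‖ ‖q.rep 1‖)⁻¹}

/-- The condition defining `pBad` may be tested on any projective coordinates of the point. -/
theorem mk_mem_pBad (ε : ℝ) (v : Fin 2 → ℚ_[p]) (hv : v ≠ 0) :
    Projectivization.mk ℚ_[p] v hv ∈ pBad p ε ↔
      ∀ a b : ℤ, (a, b) ≠ (0, 0) →
        (max (|(a : ℝ)| ^ 2) (|(b : ℝ)| ^ 2))⁻¹ * ε ≤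
          ‖(a : ℚ_[p]) * v 0 + (b : ℚ_[p]) * v 1‖ * (max ‖v 0‖ ‖v 1‖)⁻¹ := by
  obtain ⟨c, hc⟩ := Projectivization.exists_smul_eq_mk_rep ℚ_[p] v hv
  have hc0 : ‖(c : ℚ_[p])‖ ≠ 0 := norm_ne_zero_iff.mpr c.ne_zero
  have key : ∀ a b : ℤ,
      ‖(a : ℚ_[p]) * (Projectivization.mk ℚ_[p] v hv).rep 0 +
          (b : ℚ_[p]) * (Projectivization.mk ℚ_[p] v hv).rep 1‖ *
        (max ‖(Projectivization.mk ℚ_[p] v hv).rep 0‖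
          ‖(Projectivization.mk ℚ_[p] v hv).rep 1‖)⁻¹ =
      ‖(a : ℚ_[p]) * v 0 + (b : ℚ_[p]) * v 1‖ * (max ‖v 0‖ ‖v 1‖)⁻¹ := by
    intro a b
    rw [← hc]
    have h1 : (a : ℚ_[p]) * (c • v) 0 + (b : ℚ_[p]) * (c • v) 1 =
        (c : ℚ_[p]) * ((a : ℚ_[p]) * v 0 + (b : ℚ_[p]) * v 1) := by
      simp only [Pi.smul_apply, Units.smul_def, smul_eq_mul]
      ring
    have h2 : max ‖(c • v) 0‖ ‖(c • v) 1‖ = ‖(c : ℚ_[p])‖ * max ‖v 0‖ ‖v 1‖ := by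
      simp only [Pi.smul_apply, Units.smul_def, smul_eq_mul, norm_mul]
      exact (mul_max_of_nonneg _ _ (norm_nonneg _)).symm
    rw [h1, h2, norm_mul, mul_inv]
    field_simp
  simp only [pBad, Set.mem_ofPred_eq, key]

/-- The pairs `x` such that `T^n x` lies, for every `n`, in the product of the words over
`{1, ..., N}` with `pBad p ε`, where `N = [ε⁻¹] + 1`. -/
def lMadOf (ε : ℝ) : Set ((ℕ → ℕ) × ℙ ℚ_[p] (Fin 2 → ℚ_[p])) :=
  {x | ∀ n : ℕ, (∀ i, ((extShift p)^[n] x).1 i ∈ alphabet (⌊ε⁻¹⌋₊ + 1)) ∧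
    ((extShift p)^[n] x).2 ∈ pBad p ε}

/-- The set `LMad`. -/
def lMad : Set ((ℕ → ℕ) × ℙ ℚ_[p] (Fin 2 → ℚ_[p])) :=
  {x | ∃ ε : ℝ, 0 < ε ∧ x ∈ lMadOf p ε}

end LimitMad

/-!
If the numbers of sets in the collections `residueCollection p k w` are bounded, then infinitely
many tails of `w` have the same residue sets `U_k` for all `k`; after passing to a tail, `w` has
infinitely many return times `m` at which `U_k(T^m w) = U_k(w)` for all `k`. For such an `m` every
power of the matrix `A` of the prefix of length `m` is a `p`-adic limit of prefix matrices.

Let `V` be a vector of coordinates of a point `q` with `(w, q) ∈ LMad`. Integer linear forms stay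
away from zero along the vectors `V A_{w_n}`, hence also along the vectors `V Aⁿ`. If `V` were not
an eigenvector of `A`, then for a power `B` of `A` congruent to `1` modulo `p²` the vectors `V Bⁿ`
would satisfy `|V Bᵐ ∧ V Bⁿ| = |m - n| |V ∧ V B|`, so that they would fill a dense subset of a disc
of the projective line; but every disc contains rational points. So `q` is one of the at most two
fixed points of `A`. The matrices of two return times have the common irrational eigenvector `V`,
so they commute, the corresponding prefixes commute as words, and the tail is periodic.
-/

namespace LimitMad

open Filter Matrix

section Words

/-- The matrix of the prefix of length `n` of an infinite word. -/
abbrev prefixMatrix (w : ℕ → ℕ) (n : ℕ) : GL (Fin 2) ℤ := wordMatrix (prefixWord w n)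

theorem shift_iterate_apply (w : ℕ → ℕ) (n i : ℕ) : (shift^[n] w) i = w (i + n) := by
  induction n generalizing i with
  | zero => rfl
  | succ n ih => rw [Function.iterate_succ_apply', shift, ih, Nat.succ_add_eq_add_succ]

theorem prefixWord_add (w : ℕ → ℕ) (m n : ℕ) :
    prefixWord w (m + n) = prefixWord w m ++ prefixWord (shift^[m] w) n := by
  rw [prefixWord, List.range_add, List.map_append, List.map_map]
  refine congrArg _ (List.map_congr_left fun i _ => ?_)
  rw [shift_iterate_apply, Function.comp_apply, add_comm]

theorem length_prefixWord (w : ℕ → ℕ) (n : ℕ) : (prefixWord w n).length = n := by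
  simp [prefixWord]

theorem getElem?_prefixWord (w : ℕ → ℕ) {i n : ℕ} (h : i < n) :
    (prefixWord w n)[i]? = some (w i) := by
  simp [prefixWord, h]

theorem one_le_of_mem_prefixWord {w : ℕ → ℕ} (hw : ∀ i, 1 ≤ w i) {n a : ℕ}
    (ha : a ∈ prefixWord w n) : 1 ≤ a := by
  obtain ⟨i, -, rfl⟩ := List.mem_map.mp ha
  exact hw i

theorem wordMatrix_append (u v : List ℕ) : wordMatrix (u ++ v) = wordMatrix u * wordMatrix v := by
  simp [wordMatrix]

theorem wordMatrix_pow (u : List ℕ) (n : ℕ) :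
    wordMatrix u ^ n = wordMatrix (List.replicate n u).flatten := by
  induction n with
  | zero => simp [wordMatrix]
  | succ n ih => rw [pow_succ', ih, List.replicate_succ, List.flatten_cons, wordMatrix_append]

theorem prefixMatrix_add (w : ℕ → ℕ) (m n : ℕ) :
    prefixMatrix w (m + n) = prefixMatrix w m * prefixMatrix (shift^[m] w) n := by
  rw [prefixMatrix, prefixWord_add, wordMatrix_append]

theorem wordMatrix_cons (a : ℕ) (u : List ℕ) :
    wordMatrix (a :: u) = letterMatrix a * wordMatrix u := by
  simp [wordMatrix]

theorem wordMatrix_cons_mulVec_zero (a : ℕ) (u : List ℕ) (v : Fin 2 → ℤ) :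
    ((wordMatrix (a :: u)).val *ᵥ v) 0 = ((wordMatrix u).val *ᵥ v) 1 := by
  rw [wordMatrix_cons, Units.val_mul, ← mulVec_mulVec]
  simp [letterMatrix, mulVec, dotProduct]

theorem wordMatrix_cons_mulVec_one (a : ℕ) (u : List ℕ) (v : Fin 2 → ℤ) :
    ((wordMatrix (a :: u)).val *ᵥ v) 1 =
      ((wordMatrix u).val *ᵥ v) 0 + a * ((wordMatrix u).val *ᵥ v) 1 := by
  rw [wordMatrix_cons, Units.val_mul, ← mulVec_mulVec]
  simp [letterMatrix, mulVec, dotProduct]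

theorem wordMatrix_mulVec_nonneg_pos {u : List ℕ} (hu : ∀ a ∈ u, 1 ≤ a) {v : Fin 2 → ℤ}
    (h0 : 0 ≤ v 0) (h1 : 0 < v 1) :
    0 ≤ ((wordMatrix u).val *ᵥ v) 0 ∧ 0 < ((wordMatrix u).val *ᵥ v) 1 := by
  induction u with
  | nil => simp [wordMatrix, h0, h1]
  | cons a u ih =>
    obtain ⟨ha, hu⟩ := List.forall_mem_cons.mp hu
    obtain ⟨ih0, ih1⟩ := ih hu
    have : (0 : ℤ) < a := by exact_mod_cast ha
    rw [wordMatrix_cons_mulVec_zero, wordMatrix_cons_mulVec_one]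
    exact ⟨ih1.le, by positivity⟩

theorem wordMatrix_apply_zero_one_pos {u : List ℕ} (hu : ∀ a ∈ u, 1 ≤ a) (hne : u ≠ []) :
    0 < (wordMatrix u).val 0 1 := by
  obtain ⟨a, u, rfl⟩ := List.exists_cons_of_ne_nil hne
  have hpos := (wordMatrix_mulVec_nonneg_pos (List.forall_mem_cons.mp hu).2
    (v := ![0, 1]) le_rfl one_pos).2
  rw [← wordMatrix_cons_mulVec_zero a] at hpos
  simpa [mulVec, dotProduct] using hpos

theorem wordMatrix_pow_apply_zero_one_pos {u : List ℕ} (hu : ∀ a ∈ u, 1 ≤ a) (hne : u ≠ [])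
    {n : ℕ} (hn : 0 < n) : 0 < (wordMatrix u ^ n).val 0 1 := by
  rw [wordMatrix_pow]
  refine wordMatrix_apply_zero_one_pos (fun a ha => ?_) ?_
  · obtain ⟨v, hv, hav⟩ := List.mem_flatten.mp ha
    exact hu a (List.eq_of_mem_replicate hv ▸ hav)
  · obtain ⟨n, rfl⟩ := Nat.exists_eq_succ_of_ne_zero hn.ne'
    simp [List.replicate_succ, hne]

theorem prefixMatrix_pow_apply_zero_one_pos {w : ℕ → ℕ} (hw : ∀ i, 1 ≤ w i) {m n : ℕ} (hm : 0 < m)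
    (hn : 0 < n) : 0 < (prefixMatrix w m ^ n).val 0 1 := by
  refine wordMatrix_pow_apply_zero_one_pos (fun a => one_le_of_mem_prefixWord hw) ?_ hn
  rwa [← List.length_pos_iff, length_prefixWord]

theorem wordMatrix_mulVec_pos_lt {u : List ℕ} (hu : ∀ a ∈ u, 1 ≤ a) {v : Fin 2 → ℤ}
    (h0 : 0 < v 0) (h1 : v 0 < v 1) :
    0 < ((wordMatrix u).val *ᵥ v) 0 ∧
      ((wordMatrix u).val *ᵥ v) 0 < ((wordMatrix u).val *ᵥ v) 1 := by
  induction u with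
  | nil => simp [wordMatrix, h0, h1]
  | cons a u ih =>
    obtain ⟨ha, hu⟩ := List.forall_mem_cons.mp hu
    obtain ⟨ih0, ih1⟩ := ih hu
    have : (1 : ℤ) ≤ a := by exact_mod_cast ha
    rw [wordMatrix_cons_mulVec_zero, wordMatrix_cons_mulVec_one]
    exact ⟨by linarith, by nlinarith⟩

theorem wordMatrix_cons_mulVec_ediv (a : ℕ) {u : List ℕ} (hu : ∀ b ∈ u, 1 ≤ b) :
    ((wordMatrix (a :: u)).val *ᵥ ![1, 2]) 1 / ((wordMatrix (a :: u)).val *ᵥ ![1, 2]) 0 = a := by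
  obtain ⟨h0, h1⟩ := wordMatrix_mulVec_pos_lt hu (v := ![1, 2]) one_pos one_lt_two
  rw [wordMatrix_cons_mulVec_zero, wordMatrix_cons_mulVec_one,
    Int.add_mul_ediv_right _ _ (h0.trans h1).ne', Int.ediv_eq_zero_of_lt h0.le h1, zero_add]

/-- The Euclidean algorithm applied to the image of `![1, 2]` recovers the letters. -/
theorem injOn_wordMatrix : Set.InjOn wordMatrix {u | ∀ a ∈ u, 1 ≤ a} := by
  have ne_one {a : ℕ} {u : List ℕ} (hu : ∀ b ∈ a :: u, 1 ≤ b) :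
      wordMatrix (a :: u) ≠ wordMatrix [] := by
    intro h
    have hpos := wordMatrix_apply_zero_one_pos hu (List.cons_ne_nil a u)
    rw [h] at hpos
    simp [wordMatrix] at hpos
  intro u
  induction u with
  | nil =>
    rintro - (_ | ⟨b, v⟩) hv huv
    · rfl
    · exact absurd huv.symm (ne_one hv)
  | cons a u ih =>
    rintro hu (_ | ⟨b, v⟩) hv huv
    · exact absurd huv (ne_one hu)
    · have hu' := (List.forall_mem_cons.mp hu).2
      have hv' := (List.forall_mem_cons.mp hv).2
      obtain rfl : a = b := by
        have ha := wordMatrix_cons_mulVec_ediv a hu'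
        rw [huv, wordMatrix_cons_mulVec_ediv b hv'] at ha
        exact_mod_cast ha.symm
      rw [wordMatrix_cons, wordMatrix_cons, mul_right_inj] at huv
      rw [ih hu' hv' huv]

theorem apply_add_eq_of_commute {w : ℕ → ℕ} (hw : ∀ i, 1 ≤ w i) {l n i : ℕ}
    (h : Commute (prefixMatrix w l) (prefixMatrix w n)) (hi : i + l < n) : w (i + l) = w i := by
  have hpos (m n : ℕ) : ∀ a ∈ prefixWord w m ++ prefixWord w n, 1 ≤ a := fun a ha =>
    (List.mem_append.mp ha).elim (one_le_of_mem_prefixWord hw) (one_le_of_mem_prefixWord hw)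
  have hcomm : prefixWord w l ++ prefixWord w n = prefixWord w n ++ prefixWord w l :=
    injOn_wordMatrix (hpos l n) (hpos n l) (by rw [wordMatrix_append, wordMatrix_append, h.eq])
  have hletter := congrArg (·[i + l]?) hcomm
  rw [List.getElem?_append_right (by simp [length_prefixWord]),
    List.getElem?_append_left (by rwa [length_prefixWord]), length_prefixWord,
    Nat.add_sub_cancel, getElem?_prefixWord w hi, getElem?_prefixWord w (by omega)] at hletter
  exact (Option.some.inj hletter).symm

theorem IsRecurrent.isPeriodic_of_shift {w : ℕ → ℕ} (hw : IsRecurrent w) {n : ℕ}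
    (h : IsPeriodic (shift^[n] w)) : IsPeriodic w := by
  obtain ⟨l, hl, hper⟩ := h
  refine ⟨l, hl, funext fun i => ?_⟩
  obtain ⟨m, hm, hnm⟩ :=
    (hw (prefixWord w (i + l + 1)) ⟨0, by rw [length_prefixWord]; rfl⟩).exists_gt n
  rw [Set.mem_ofPred_eq, length_prefixWord] at hm
  have hblock {j : ℕ} (hj : j < i + l + 1) : w (j + m) = w j := by
    have hletter := congrArg (·[j]?) hm
    simp only [getElem?_prefixWord _ hj, Option.some.injEq] at hletter
    rwa [shift_iterate_apply] at hletter
  have htail := congrFun hper (i + (m - n))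
  rw [shift_iterate_apply, shift_iterate_apply, shift_iterate_apply,
    show i + (m - n) + l + n = i + l + m by omega, show i + (m - n) + n = i + m by omega] at htail
  calc (shift^[l] w) i = w (i + l + m) := by rw [shift_iterate_apply, hblock (by omega)]
    _ = w (i + m) := htail
    _ = w i := hblock (by omega)

end Words

section Residues

theorem finite_of_eventually_encard_image_eval_le {α : ℕ → Type*} {S : Set (∀ k, α k)}
    (hS : ∀ x ∈ S, ∀ y ∈ S, ∀ k l, k ≤ l → x l = y l → x k = y k) {C : ℕ}
    (hC : ∀ᶠ k in atTop, ((fun x : ∀ k, α k => x k) '' S).encard ≤ C) : S.Finite := by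
  by_contra hinf
  obtain ⟨T, hTS, hcard⟩ := Set.Infinite.exists_subset_card_eq hinf (C + 1)
  have hsep : ∀ᶠ k in atTop, ∀ x ∈ T, ∀ y ∈ T, x k = y k → x = y := by
    refine (T.eventually_all).mpr fun x hx => (T.eventually_all).mpr fun y hy => ?_
    by_cases hxy : x = y
    · exact Eventually.of_forall fun _ _ => hxy
    · obtain ⟨k, hk⟩ := Function.ne_iff.mp hxy
      filter_upwards [eventually_ge_atTop k] with l hl heq
      exact absurd (hS x (hTS hx) y (hTS hy) k l hl heq) hk
  obtain ⟨k, hinj, hle⟩ := (hsep.and hC).exists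
  have hle_image := Set.encard_le_encard (Set.image_mono (f := fun x : ∀ k, α k => x k) hTS)
  rw [Set.InjOn.encard_image fun x hx y hy => hinj x hx y hy,
    Set.encard_coe_eq_coe_finsetCard, hcard] at hle_image
  exact absurd (hle_image.trans hle) (by norm_cast; omega)

variable {p : ℕ} {w : ℕ → ℕ}

theorem intCast_eq_of_reduction_eq {k : ℕ} {g h : GL (Fin 2) ℤ}
    (hgh : reduction p k g = reduction p k h) (i j : Fin 2) :
    (g.val i j : ZMod (p ^ k)) = h.val i j :=
  congrArg (fun A : GL (Fin 2) (ZMod (p ^ k)) => A.val i j) hgh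

theorem image_prefixResidues {k l : ℕ} (hkl : k ≤ l) (w : ℕ → ℕ) :
    GeneralLinearGroup.map (ZMod.castHom (pow_dvd_pow p hkl) (ZMod (p ^ k))) ''
      prefixResidues p l w = prefixResidues p k w := by
  rw [prefixResidues, ← Set.range_comp]
  refine congrArg Set.range (funext fun n => ?_)
  ext i j
  simp [reduction]

/-- The times at which the shifted word has the residue sets `U_k` of the word itself, for all
`k`. -/
def returnTimes (p : ℕ) (w : ℕ → ℕ) : Set ℕ :=
  {m | ∀ k, prefixResidues p k (shift^[m] w) = prefixResidues p k w}

theorem exists_infinite_returnTimes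
    (hbdd : ∃ C : ℕ, ∀ k : ℕ, 1 ≤ k → (residueCollection p k w).encard ≤ C) :
    ∃ n, (returnTimes p (shift^[n] w)).Infinite := by
  obtain ⟨C, hC⟩ := hbdd
  let U (n k : ℕ) : Set (GL (Fin 2) (ZMod (p ^ k))) := prefixResidues p k (shift^[n] w)
  have hfin : (Set.range U).Finite := by
    refine finite_of_eventually_encard_image_eval_le (C := C) ?_ ?_
    · rintro _ ⟨m, rfl⟩ _ ⟨n, rfl⟩ k l hkl hmn
      simp only [U] at hmn ⊢
      rw [← image_prefixResidues hkl, hmn, image_prefixResidues hkl]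
    · filter_upwards [eventually_ge_atTop 1] with k hk
      rw [← Set.range_comp]
      exact hC k hk
  have : Finite (Set.range U) := hfin
  obtain ⟨⟨_, n, rfl⟩, hn⟩ := Finite.exists_infinite_fiber (Set.rangeFactorization U)
  refine ⟨n, Set.infinite_of_forall_exists_gt fun L => ?_⟩
  obtain ⟨m, hm, hlt⟩ := (Set.infinite_coe_iff.mp hn).exists_gt (L + n)
  refine ⟨m - n, fun k => ?_, by omega⟩
  rw [← Function.iterate_add_apply, Nat.sub_add_cancel (by omega)]
  exact congrFun (congrArg Subtype.val hm) k

theorem exists_reduction_eq_of_mem_returnTimes {m : ℕ} (hm : m ∈ returnTimes p w) :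
    ∀ g ∈ Submonoid.powers (prefixMatrix w m), ∀ k,
      ∃ h ∈ Set.range (prefixMatrix w), reduction p k g = reduction p k h := by
  rintro _ ⟨j, rfl⟩ k
  suffices hmem : reduction p k (prefixMatrix w m ^ j) ∈ prefixResidues p k w by
    obtain ⟨n, hn⟩ := hmem
    exact ⟨_, ⟨n, rfl⟩, hn.symm⟩
  induction j with
  | zero => exact ⟨0, by simp [prefixWord, wordMatrix]⟩
  | succ j ih =>
    rw [← hm k] at ih
    obtain ⟨n, hn⟩ := ih
    refine ⟨m + n, ?_⟩
    simp only at hn ⊢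
    rw [prefixWord_add, wordMatrix_append, map_mul, hn, ← map_mul, pow_succ']

end Residues

section Plane

variable {R K : Type*} [CommRing R] [Field K]

/-- The determinant of the pair of row vectors `V`, `W`; over a field it vanishes if and only if
`V` and `W` are proportional. -/
def wedge (V W : Fin 2 → R) : R := V 0 * W 1 - V 1 * W 0

theorem wedge_vecMul_vecMul (V W : Fin 2 → R) (A : Matrix (Fin 2) (Fin 2) R) :
    wedge (V ᵥ* A) (W ᵥ* A) = A.det * wedge V W := by
  simp only [wedge, vecMul, dotProduct, Fin.sum_univ_two, det_fin_two]
  ring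

theorem exists_eq_smul_of_wedge_eq_zero {V W : Fin 2 → K} (hV : V ≠ 0) (h : wedge V W = 0) :
    ∃ c : K, W = c • V := by
  rw [wedge, sub_eq_zero] at h
  by_cases h0 : V 0 = 0
  · have h1 : V 1 ≠ 0 := fun h1 => hV (by ext i; fin_cases i <;> assumption)
    have hW : W 0 = 0 := by simpa [h0, h1] using h
    refine ⟨W 1 / V 1, funext (Fin.forall_fin_two.mpr ⟨?_, ?_⟩)⟩
    · simp [h0, hW]
    · simp [h1]
  · refine ⟨W 0 / V 0, funext (Fin.forall_fin_two.mpr ⟨?_, ?_⟩)⟩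
    · simp [h0]
    · rw [Pi.smul_apply, smul_eq_mul, div_mul_eq_mul_div, eq_div_iff h0]
      linear_combination h

theorem mk_eq_mk_of_wedge_eq_zero {V W : Fin 2 → K} (hV : V ≠ 0) (hW : W ≠ 0)
    (h : wedge V W = 0) : Projectivization.mk K V hV = Projectivization.mk K W hW := by
  obtain ⟨c, rfl⟩ := exists_eq_smul_of_wedge_eq_zero hV h
  exact ((Projectivization.mk_eq_mk_iff' K _ _ _ _).mpr ⟨c, rfl⟩).symm

/-- The Lucas sequence `U_n(P, Q)`. If `P` and `Q` are the trace and the determinant of a matrix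
`A` of size two, then `A ^ n = U_n • A + c • 1` for some scalar `c`. -/
def lucasU (P Q : R) : ℕ → R
  | 0 => 0
  | 1 => 1
  | n + 2 => P * lucasU P Q (n + 1) - Q * lucasU P Q n

theorem map_lucasU {S : Type*} [CommRing S] (f : R →+* S) (P Q : R) (n : ℕ) :
    f (lucasU P Q n) = lucasU (f P) (f Q) n := by
  induction n using Nat.twoStepInduction with
  | zero => simp [lucasU]
  | one => simp [lucasU]
  | more n h₀ h₁ => simp [lucasU, h₀, h₁]

theorem lucasU_two_one (n : ℕ) : lucasU (2 : R) 1 n = n := by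
  induction n using Nat.twoStepInduction with
  | zero => simp [lucasU]
  | one => simp [lucasU]
  | more n h₀ h₁ =>
    rw [lucasU, h₀, h₁]
    push_cast
    ring

theorem wedge_vecMul_pow (V : Fin 2 → R) (A : Matrix (Fin 2) (Fin 2) R) (n : ℕ) :
    wedge V (V ᵥ* A ^ n) = lucasU A.trace A.det n * wedge V (V ᵥ* A) := by
  induction n using Nat.twoStepInduction with
  | zero => simp [lucasU, wedge, mul_comm]
  | one => simp [lucasU]
  | more n h₀ h₁ =>
    have cayley_hamilton : A ^ 2 = A.trace • A - A.det • 1 := by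
      ext i j
      fin_cases i <;> fin_cases j <;>
        simp [pow_two, mul_apply, trace_fin_two, det_fin_two] <;> ring
    have recurrence : V ᵥ* A ^ (n + 2) = A.trace • V ᵥ* A ^ (n + 1) - A.det • V ᵥ* A ^ n := by
      rw [pow_add, cayley_hamilton, mul_sub, mul_smul_comm, mul_smul_comm, mul_one, ← pow_succ,
        vecMul_sub, vecMul_smul, vecMul_smul]
    rw [lucasU, sub_mul, mul_assoc, mul_assoc, ← h₀, ← h₁, recurrence]
    simp only [wedge, Pi.sub_apply, Pi.smul_apply, smul_eq_mul]
    ring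

theorem lucasU_ne_zero_of_pow_apply_ne_zero {A : Matrix (Fin 2) (Fin 2) R} {n : ℕ}
    (h : (A ^ n) 0 1 ≠ 0) : lucasU A.trace A.det n ≠ 0 := by
  intro h0
  have := wedge_vecMul_pow ![1, 0] A n
  rw [h0, zero_mul] at this
  exact h (by simpa [wedge, vecMul, dotProduct] using this)

/-- The points of the projective line fixed by the right action of `A` on row vectors, together
with the points represented by vectors which `A` sends to zero. -/
def leftEigenpoints (A : Matrix (Fin 2) (Fin 2) K) : Set (ℙ K (Fin 2 → K)) :=
  {q | wedge q.rep (q.rep ᵥ* A) = 0}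

theorem wedge_vecMul_self (V : Fin 2 → R) (A : Matrix (Fin 2) (Fin 2) R) :
    wedge V (V ᵥ* A) =
      A 0 1 * V 0 ^ 2 + (A 1 1 - A 0 0) * (V 0 * V 1) - A 1 0 * V 1 ^ 2 := by
  simp only [wedge, vecMul, dotProduct, Fin.sum_univ_two]
  ring

section leftEigenpoints

variable {A : Matrix (Fin 2) (Fin 2) K} {q : ℙ K (Fin 2 → K)}

theorem rep_one_ne_zero_of_mem_leftEigenpoints (hA : A 0 1 ≠ 0) (hq : q ∈ leftEigenpoints A) :
    q.rep 1 ≠ 0 := by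
  intro h1
  have h0 : q.rep 0 = 0 := by simpa [leftEigenpoints, wedge_vecMul_self, h1, hA] using hq
  exact q.rep_nonzero (by ext i; fin_cases i <;> assumption)

theorem quadratic_eq_zero_of_mem_leftEigenpoints (hA : A 0 1 ≠ 0)
    (hq : q ∈ leftEigenpoints A) :
    A 0 1 * (q.rep 0 / q.rep 1) ^ 2 + (A 1 1 - A 0 0) * (q.rep 0 / q.rep 1) - A 1 0 = 0 := by
  have h1 := rep_one_ne_zero_of_mem_leftEigenpoints hA hq
  rw [leftEigenpoints, Set.mem_ofPred_eq, wedge_vecMul_self] at hq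
  field_simp
  linear_combination hq

theorem injOn_leftEigenpoints (hA : A 0 1 ≠ 0) :
    Set.InjOn (fun q : ℙ K (Fin 2 → K) => q.rep 0 / q.rep 1) (leftEigenpoints A) := by
  intro q hq r hr hqr
  rw [← q.mk_rep, ← r.mk_rep]
  refine mk_eq_mk_of_wedge_eq_zero _ _ ?_
  rw [wedge, mul_comm (q.rep 1), sub_eq_zero]
  exact (div_eq_div_iff (rep_one_ne_zero_of_mem_leftEigenpoints hA hq)
    (rep_one_ne_zero_of_mem_leftEigenpoints hA hr)).mp hqr

theorem encard_leftEigenpoints_le_two (hA : A 0 1 ≠ 0) : (leftEigenpoints A).encard ≤ 2 := by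
  obtain hempty | ⟨r, hr⟩ := (leftEigenpoints A).eq_empty_or_nonempty
  · simp [hempty]
  -- Vieta: the sum of the roots of `A₀₁ x² + (A₁₁ - A₀₀) x - A₁₀` is `(A₀₀ - A₁₁) / A₀₁`.
  have hmaps : Set.MapsTo (fun q : ℙ K (Fin 2 → K) => q.rep 0 / q.rep 1) (leftEigenpoints A)
      {r.rep 0 / r.rep 1, (A 0 0 - A 1 1) / A 0 1 - r.rep 0 / r.rep 1} := by
    intro q hq
    have hfactor : (q.rep 0 / q.rep 1 - r.rep 0 / r.rep 1) *
        (q.rep 0 / q.rep 1 - ((A 0 0 - A 1 1) / A 0 1 - r.rep 0 / r.rep 1)) = 0 := by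
      refine mul_left_cancel₀ hA ?_
      linear_combination quadratic_eq_zero_of_mem_leftEigenpoints hA hq -
        quadratic_eq_zero_of_mem_leftEigenpoints hA hr +
        (r.rep 0 / r.rep 1 - q.rep 0 / q.rep 1) * mul_div_cancel₀ (A 0 0 - A 1 1) hA
    simpa [sub_eq_zero] using hfactor
  refine (Set.encard_le_encard_of_injOn hmaps (injOn_leftEigenpoints hA)).trans ?_
  refine (Set.encard_insert_le _ _).trans (le_of_eq ?_)
  rw [Set.encard_singleton, one_add_one_eq_two]

end leftEigenpoints

section chart

/-- The affine coordinate of a point of the projective line in the chart where the coordinate `i`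
does not vanish. -/
def chart (i : Fin 2) (V : Fin 2 → K) : K := V i.rev / V i

theorem exists_dotProduct_eq_mul_chart_sub (i : Fin 2) (a : ℤ) : ∃ v : Fin 2 → ℤ, v ≠ 0 ∧
    ∀ V : Fin 2 → K, V i ≠ 0 → V ⬝ᵥ (Int.cast ∘ v) = V i * (chart i V - a) := by
  refine ⟨fun j => if j = i then -a else 1, ?_, fun V hV => ?_⟩
  · intro h
    have hrev : i.rev ≠ i := by fin_cases i <;> decide
    simpa [hrev] using congrFun h i.rev
  · rw [chart, mul_sub, mul_div_cancel₀ _ hV]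
    fin_cases i <;> simp [dotProduct, Fin.rev] <;> ring

theorem norm_chart_sub_chart {F : Type*} [NormedField F] {V W : Fin 2 → F} {i : Fin 2}
    (hV : V i ≠ 0) (hW : W i ≠ 0) :
    ‖chart i V - chart i W‖ = ‖wedge V W‖ / (‖V i‖ * ‖W i‖) := by
  rw [chart, chart, div_sub_div _ _ hV hW, norm_div, norm_mul]
  congr 1
  fin_cases i
  · rw [← norm_neg]
    simp [wedge, Fin.rev]
  · simp [wedge, Fin.rev]

end chart

end Plane

section PiNorm

variable {m n E R : Type*} [Fintype m] [Fintype n] [SeminormedAddCommGroup E] [NormedRing R]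
  [IsUltrametricDist R]

theorem exists_norm_apply_eq_norm [Nonempty m] (x : m → E) : ∃ i, ‖x i‖ = ‖x‖ := by
  obtain ⟨i, -, hi⟩ := Finset.exists_mem_eq_sup Finset.univ Finset.univ_nonempty fun i => ‖x i‖₊
  exact ⟨i, congrArg NNReal.toReal hi.symm⟩

theorem norm_eq_max (V : Fin 2 → E) : ‖V‖ = max ‖V 0‖ ‖V 1‖ := by
  refine le_antisymm ((pi_norm_le_iff_of_nonneg (by positivity)).mpr ?_)
    (max_le (norm_le_pi_norm V 0) (norm_le_pi_norm V 1))
  exact Fin.forall_fin_two.mpr ⟨le_max_left _ _, le_max_right _ _⟩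

theorem norm_dotProduct_le (x y : m → R) : ‖x ⬝ᵥ y‖ ≤ ‖x‖ * ‖y‖ :=
  IsUltrametricDist.norm_sum_le_of_forall_le_of_nonneg (by positivity) fun i _ =>
    (norm_mul_le _ _).trans (by gcongr <;> exact norm_le_pi_norm _ i)

theorem norm_vecMul_le (x : m → R) {A : Matrix m n R} {r : ℝ} (hr : 0 ≤ r)
    (hA : ∀ i j, ‖A i j‖ ≤ r) : ‖x ᵥ* A‖ ≤ ‖x‖ * r := by
  refine (pi_norm_le_iff_of_nonneg (by positivity)).mpr fun j => ?_
  refine (norm_dotProduct_le x fun i => A i j).trans ?_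
  gcongr
  exact (pi_norm_le_iff_of_nonneg hr).mpr fun i => hA i j

end PiNorm

variable {p : ℕ} [Fact p.Prime]

section Density

theorem denseRange_of_norm_sub_le {f : ℕ → ℤ_[p]}
    (hf : ∀ m n : ℕ, ‖(m - n : ℤ_[p])‖ ≤ ‖f m - f n‖) : DenseRange f := by
  have mem_ker {e : ℕ} {x : ℤ_[p]} :
      ‖x‖ ≤ (p : ℝ) ^ (-e : ℤ) ↔ PadicInt.toZModPow e x = 0 := by
    rw [PadicInt.norm_le_pow_iff_mem_span_pow, ← PadicInt.ker_toZModPow, RingHom.mem_ker]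
  intro y
  refine Metric.mem_closure_range_iff.mpr fun ε hε => ?_
  obtain ⟨e, he⟩ := PadicInt.exists_pow_neg_lt p hε
  have hinj : Function.Injective fun j : ZMod (p ^ e) => PadicInt.toZModPow e (f j.val) := by
    intro i j hij
    have hsub : PadicInt.toZModPow e (f i.val - f j.val) = 0 := by
      rw [map_sub, sub_eq_zero]
      exact hij
    have h := mem_ker.mp ((hf i.val j.val).trans (mem_ker.mpr hsub))
    simpa [sub_eq_zero] using h
  obtain ⟨j, hj⟩ := Finite.surjective_of_injective hinj (PadicInt.toZModPow e y)
  refine ⟨j.val, (dist_eq_norm y _).trans_lt (lt_of_le_of_lt (mem_ker.mpr ?_) he)⟩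
  rw [map_sub, sub_eq_zero]
  exact hj.symm

theorem exists_eq_padicInt_mul {y δ : ℚ_[p]} (hδ : δ ≠ 0) (hy : ‖y‖ ≤ ‖δ‖) :
    ∃ z : ℤ_[p], y = z * δ := by
  have hz : ‖y / δ‖ ≤ 1 := by rwa [norm_div, div_le_one (norm_pos_iff.mpr hδ)]
  exact ⟨⟨y / δ, hz⟩, (div_mul_cancel₀ y hδ).symm⟩

theorem closedBall_subset_closure_range {x : ℕ → ℚ_[p]} {δ : ℚ_[p]} (hδ : δ ≠ 0)
    (hx : ∀ m n : ℕ, ‖x m - x n‖ = ‖(m - n : ℚ_[p])‖ * ‖δ‖) :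
    Metric.closedBall (x 0) ‖δ‖ ⊆ closure (Set.range x) := by
  have hδ' : 0 < ‖δ‖ := norm_pos_iff.mpr hδ
  have hx_le (n : ℕ) : ‖x n - x 0‖ ≤ ‖δ‖ := by
    have hn : ‖((n : ℤ) : ℚ_[p])‖ ≤ 1 := Padic.norm_int_le_one n
    rw [hx]
    exact mul_le_of_le_one_left hδ'.le (by simpa using hn)
  choose f hf using fun n => exists_eq_padicInt_mul hδ (hx_le n)
  have hdense : DenseRange f := by
    refine denseRange_of_norm_sub_le fun m n => le_of_eq ?_
    refine mul_right_cancel₀ hδ'.ne' ?_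
    calc ‖(m - n : ℤ_[p])‖ * ‖δ‖ = ‖x m - x n‖ := by rw [hx]; simp [PadicInt.norm_def]
      _ = ‖(x m - x 0) - (x n - x 0)‖ := by rw [sub_sub_sub_cancel_right]
      _ = ‖f m - f n‖ * ‖δ‖ := by rw [hf, hf, ← sub_mul, norm_mul, PadicInt.norm_def]; simp
  intro y hy
  obtain ⟨z, hz⟩ := exists_eq_padicInt_mul hδ (mem_closedBall_iff_norm.mp hy)
  refine Metric.mem_closure_range_iff.mpr fun ε hε => ?_
  obtain ⟨n, hn⟩ := Metric.mem_closure_range_iff.mp (hdense z) (ε / ‖δ‖) (by positivity)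
  refine ⟨n, ?_⟩
  rw [dist_eq_norm, lt_div_iff₀ hδ'] at hn
  calc dist y (x n) = ‖(y - x 0) - (x n - x 0)‖ := by rw [sub_sub_sub_cancel_right, dist_eq_norm]
    _ = ‖z - f n‖ * ‖δ‖ := by rw [hz, hf, ← sub_mul, norm_mul, PadicInt.norm_def]; simp
    _ < ε := hn

end Density

section RowMul

/-- The map `GL(2, ℤ) → GL(2, ℚ_p)` induced by the inclusion of `ℤ` in `ℚ_p`. -/
noncomputable abbrev toPadic : GL (Fin 2) ℤ →* GL (Fin 2) ℚ_[p] :=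
  GeneralLinearGroup.map (Int.castRingHom ℚ_[p])

/-- The right action of integer matrices on `p`-adic row vectors. Since letter matrices are
symmetric, `T ^ n` acts on a second coordinate represented by `V` as `V ↦ rowMul V A` with `A` the
matrix of the prefix of length `n`. -/
noncomputable def rowMul (V : Fin 2 → ℚ_[p]) (g : GL (Fin 2) ℤ) : Fin 2 → ℚ_[p] :=
  V ᵥ* (toPadic g).val

variable (V : Fin 2 → ℚ_[p]) {g h : GL (Fin 2) ℤ} {k : ℕ}

@[simp]
theorem rowMul_one : rowMul V 1 = V := by
  simp [rowMul]

theorem rowMul_mul (g h : GL (Fin 2) ℤ) : rowMul V (g * h) = rowMul (rowMul V g) h := by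
  rw [rowMul, rowMul, rowMul, vecMul_vecMul, map_mul, Units.val_mul]

theorem norm_rowMul (g : GL (Fin 2) ℤ) : ‖rowMul V g‖ = ‖V‖ := by
  have hle (V : Fin 2 → ℚ_[p]) (g : GL (Fin 2) ℤ) : ‖rowMul V g‖ ≤ ‖V‖ := by
    refine (norm_vecMul_le V zero_le_one fun i j => ?_).trans_eq (mul_one _)
    exact Padic.norm_int_le_one (g.val i j)
  refine (hle V g).antisymm ?_
  calc ‖V‖ = ‖rowMul (rowMul V g) g⁻¹‖ := by rw [← rowMul_mul, mul_inv_cancel, rowMul_one]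
    _ ≤ ‖rowMul V g‖ := hle _ _

theorem rowMul_ne_zero {V : Fin 2 → ℚ_[p]} (hV : V ≠ 0) (g : GL (Fin 2) ℤ) :
    rowMul V g ≠ 0 := by
  rw [← norm_ne_zero_iff, norm_rowMul]
  exact norm_ne_zero_iff.mpr hV

theorem norm_rowMul_sub_rowMul_le (hgh : reduction p k g = reduction p k h) :
    ‖rowMul V g - rowMul V h‖ ≤ ‖V‖ * (p : ℝ) ^ (-k : ℤ) := by
  rw [rowMul, rowMul, ← vecMul_sub]
  refine norm_vecMul_le V (by positivity) fun i j => ?_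
  have hdvd : (p ^ k : ℤ) ∣ g.val i j - h.val i j := by
    have hcast : ((g.val i j - h.val i j : ℤ) : ZMod (p ^ k)) = 0 := by
      rw [Int.cast_sub, intCast_eq_of_reduction_eq hgh, sub_self]
    exact_mod_cast (ZMod.intCast_zmod_eq_zero_iff_dvd _ _).mp hcast
  simpa using (Padic.norm_int_le_pow_iff_dvd _ _).mpr hdvd

end RowMul

section Powers

variable {B : GL (Fin 2) ℤ}

theorem norm_lucasU (hB : reduction p 2 B = 1) {n : ℕ} (hn : ¬p ^ 2 ∣ n) :
    ‖((lucasU B.val.trace B.val.det n : ℤ) : ℚ_[p])‖ = ‖(n : ℚ_[p])‖ := by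
  have hentry := intCast_eq_of_reduction_eq (hB.trans (map_one _).symm)
  have htrace : (B.val.trace : ZMod (p ^ 2)) = 2 := by
    simp [trace_fin_two, hentry, one_add_one_eq_two]
  have hdet : (B.val.det : ZMod (p ^ 2)) = 1 := by
    simp [det_fin_two, hentry]
  set u : ℤ := lucasU B.val.trace B.val.det n
  have hcast : ((u - n : ℤ) : ZMod (p ^ 2)) = 0 := by
    have hu := map_lucasU (Int.castRingHom (ZMod (p ^ 2))) B.val.trace B.val.det n
    simp only [eq_intCast, htrace, hdet, lucasU_two_one] at hu
    simp [u, hu]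
  have hdvd : (p ^ 2 : ℤ) ∣ u - n := by
    exact_mod_cast (ZMod.intCast_zmod_eq_zero_iff_dvd _ _).mp hcast
  have hsub : ‖(u : ℚ_[p]) - n‖ ≤ (p : ℝ) ^ (-2 : ℤ) := by
    exact_mod_cast (Padic.norm_int_le_pow_iff_dvd _ 2).mpr hdvd
  have hlt : (p : ℝ) ^ (-2 : ℤ) < ‖(n : ℚ_[p])‖ := by
    rw [← not_le]
    intro hle
    refine hn (Int.natCast_dvd_natCast.mp ?_)
    exact_mod_cast (Padic.norm_int_le_pow_iff_dvd (n : ℤ) 2).mp (by exact_mod_cast hle)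
  exact Padic.norm_eq_of_norm_sub_lt_right (hsub.trans_lt hlt)

theorem det_toPadic (A : GL (Fin 2) ℤ) : (toPadic (p := p) A).val.det = A.val.det := by
  simp [det_fin_two]

theorem wedge_rowMul_pow (V : Fin 2 → ℚ_[p]) (A : GL (Fin 2) ℤ) (n : ℕ) :
    wedge V (rowMul V (A ^ n)) =
      ((lucasU A.val.trace A.val.det n : ℤ) : ℚ_[p]) * wedge V (rowMul V A) := by
  have htrace : (toPadic (p := p) A).val.trace = A.val.trace := by
    simp [trace_fin_two]
  rw [rowMul, rowMul, map_pow, Units.val_pow_eq_pow_val, wedge_vecMul_pow, htrace, det_toPadic]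
  exact congrArg (· * _) (map_lucasU (Int.castRingHom ℚ_[p]) _ _ n).symm

theorem norm_wedge_rowMul_pow (V : Fin 2 → ℚ_[p]) (hB : reduction p 2 B = 1) (n : ℕ) :
    ‖wedge V (rowMul V (B ^ n))‖ = ‖(n : ℚ_[p])‖ * ‖wedge V (rowMul V B)‖ := by
  induction n using Nat.strong_induction_on with
  | _ n ih =>
    by_cases hn : p ^ 2 ∣ n
    · obtain rfl | hpos := n.eq_zero_or_pos
      · simp [wedge, mul_comm]
      have hp : p.Prime := Fact.out
      obtain ⟨l, rfl⟩ := (dvd_pow_self p two_ne_zero).trans hn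
      have hl : l < p * l := lt_mul_of_one_lt_left (pos_of_mul_pos_right hpos p.zero_le) hp.one_lt
      have hBl : reduction p 2 (B ^ l) = 1 := by rw [map_pow, hB, one_pow]
      have hpp : ¬p ^ 2 ∣ p := fun h => absurd (Nat.le_of_dvd hp.pos h) (by nlinarith [hp.two_le])
      rw [mul_comm p, pow_mul, wedge_rowMul_pow, norm_mul, norm_lucasU hBl hpp, ih l hl,
        Nat.cast_mul, norm_mul]
      ring
    · rw [wedge_rowMul_pow, norm_mul, norm_lucasU hB hn]

theorem norm_wedge_rowMul_rowMul (V W : Fin 2 → ℚ_[p]) (g : GL (Fin 2) ℤ) :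
    ‖wedge (rowMul V g) (rowMul W g)‖ = ‖wedge V W‖ := by
  have hdet : ‖(g.val.det : ℚ_[p])‖ = 1 := by
    obtain h | h := Int.isUnit_iff.mp ((isUnit_iff_isUnit_det _).mp g.isUnit) <;> simp [h]
  rw [rowMul, rowMul, wedge_vecMul_vecMul, norm_mul, det_toPadic, hdet, one_mul]

theorem norm_wedge_rowMul_pow_rowMul_pow (V : Fin 2 → ℚ_[p]) (hB : reduction p 2 B = 1)
    (m n : ℕ) :
    ‖wedge (rowMul V (B ^ m)) (rowMul V (B ^ n))‖ =
      ‖(m - n : ℚ_[p])‖ * ‖wedge V (rowMul V B)‖ := by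
  have hle {m n : ℕ} (hmn : m ≤ n) : ‖wedge (rowMul V (B ^ m)) (rowMul V (B ^ n))‖ =
      ‖(n - m : ℚ_[p])‖ * ‖wedge V (rowMul V B)‖ := by
    obtain ⟨d, rfl⟩ := Nat.exists_eq_add_of_le' hmn
    rw [pow_add, rowMul_mul, norm_wedge_rowMul_rowMul, norm_wedge_rowMul_pow V hB]
    simp
  obtain hmn | hnm := le_total m n
  · rw [hle hmn, norm_sub_rev]
  · rw [← hle hnm, wedge, wedge, ← norm_neg]
    ring_nf

end Powers

section UniformIrrationality

/-- Every nonzero integer linear form stays away from zero along the vectors `rowMul V g`, `g ∈ S`: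
the part of the condition `LMad` on a projective point that survives passing to limits of `g` in
the `p`-adic topology. -/
def IsUniformlyIrrational (V : Fin 2 → ℚ_[p]) (S : Set (GL (Fin 2) ℤ)) : Prop :=
  ∀ v : Fin 2 → ℤ, v ≠ 0 → ∃ η : ℝ, 0 < η ∧ ∀ g ∈ S, η ≤ ‖rowMul V g ⬝ᵥ (Int.cast ∘ v)‖

variable {V : Fin 2 → ℚ_[p]} {S S' : Set (GL (Fin 2) ℤ)} {A B : GL (Fin 2) ℤ}

theorem IsUniformlyIrrational.mono_of_reduction_eq (hS : IsUniformlyIrrational V S)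
    (hS' : ∀ g ∈ S', ∀ k, ∃ h ∈ S, reduction p k g = reduction p k h) :
    IsUniformlyIrrational V S' := by
  intro v hv
  obtain ⟨η, hη, hle⟩ := hS v hv
  refine ⟨η, hη, fun g hg => le_of_not_gt fun hlt => ?_⟩
  have hv1 : ‖(Int.cast ∘ v : Fin 2 → ℚ_[p])‖ ≤ 1 :=
    (pi_norm_le_iff_of_nonneg zero_le_one).mpr fun i => Padic.norm_int_le_one (v i)
  obtain ⟨k, hk⟩ : ∃ k : ℕ, ‖V‖ * (p : ℝ) ^ (-k : ℤ) < η := by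
    obtain ⟨k, hk⟩ := PadicInt.exists_pow_neg_lt p (show 0 < η / (‖V‖ + 1) by positivity)
    rw [lt_div_iff₀ (by positivity)] at hk
    refine ⟨k, lt_of_le_of_lt ?_ hk⟩
    rw [mul_comm]
    gcongr
    exact (lt_add_one _).le
  obtain ⟨h, hh, hgh⟩ := hS' g hg k
  have hclose : ‖rowMul V h ⬝ᵥ (Int.cast ∘ v) - rowMul V g ⬝ᵥ (Int.cast ∘ v)‖ < η := by
    rw [← sub_dotProduct]
    refine lt_of_le_of_lt ?_ hk
    refine (norm_dotProduct_le _ _).trans (mul_le_of_le_one_right (norm_nonneg _) hv1) |>.trans ?_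
    exact norm_rowMul_sub_rowMul_le V hgh.symm
  refine (hle h hh).not_gt ?_
  rw [← sub_add_cancel (rowMul V h ⬝ᵥ (Int.cast ∘ v)) (rowMul V g ⬝ᵥ (Int.cast ∘ v))]
  exact (IsUltrametricDist.norm_add_le_max _ _).trans_lt (max_lt hclose hlt)

theorem norm_rowMul_apply_of_reduction_eq_one (V : Fin 2 → ℚ_[p]) {i : Fin 2} (hi : ‖V i‖ = ‖V‖)
    (hB : reduction p 2 B = 1) : ‖rowMul V B i‖ = ‖V‖ := by
  obtain rfl | hV := eq_or_ne V 0
  · simp [rowMul]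
  have : 0 < ‖V‖ := norm_pos_iff.mpr hV
  have hsub : ‖rowMul V B - V‖ ≤ ‖V‖ * (p : ℝ) ^ (-2 : ℤ) := by
    simpa using norm_rowMul_sub_rowMul_le V (hB.trans (map_one _).symm)
  have hp : (1 : ℝ) < p := by exact_mod_cast (Fact.out : p.Prime).one_lt
  rw [← hi]
  refine Padic.norm_eq_of_norm_sub_lt_right ?_
  calc ‖rowMul V B i - V i‖ ≤ ‖rowMul V B - V‖ := norm_le_pi_norm (rowMul V B - V) i
    _ ≤ ‖V‖ * (p : ℝ) ^ (-2 : ℤ) := hsub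
    _ < ‖V‖ * 1 := by gcongr; exact zpow_lt_one_of_neg₀ hp (by norm_num)
    _ = ‖V i‖ := by rw [mul_one, hi]

theorem norm_chart_rowMul_pow_sub {i : Fin 2} (hi : ‖V i‖ = ‖V‖) (hV : V ≠ 0)
    (hB : reduction p 2 B = 1) (m n : ℕ) :
    ‖chart i (rowMul V (B ^ m)) - chart i (rowMul V (B ^ n))‖ =
      ‖(m - n : ℚ_[p])‖ * ‖wedge V (rowMul V B) / V i ^ 2‖ := by
  have hnorm (n : ℕ) : ‖rowMul V (B ^ n) i‖ = ‖V‖ :=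
    norm_rowMul_apply_of_reduction_eq_one V hi (by rw [map_pow, hB, one_pow])
  have hne (n : ℕ) : rowMul V (B ^ n) i ≠ 0 := by
    rw [← norm_ne_zero_iff, hnorm]
    exact norm_ne_zero_iff.mpr hV
  rw [norm_chart_sub_chart (hne m) (hne n), hnorm, hnorm,
    norm_wedge_rowMul_pow_rowMul_pow V hB, norm_div, norm_pow, hi, mul_div_assoc, sq]

theorem exists_norm_intCast_sub_le {x δ : ℚ_[p]} (hx : ‖x‖ ≤ 1) (hδ : δ ≠ 0) :
    ∃ a : ℤ, ‖a - x‖ ≤ ‖δ‖ := by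
  obtain ⟨z, rfl⟩ := exists_eq_padicInt_mul one_ne_zero (hx.trans_eq norm_one.symm)
  obtain ⟨a, ha⟩ := Metric.mem_closure_range_iff.mp (PadicInt.denseRange_intCast z) ‖δ‖
    (norm_pos_iff.mpr hδ)
  rw [dist_comm, dist_eq_norm, PadicInt.norm_def] at ha
  exact ⟨a, by simpa using ha.le⟩

/-- The points `V * B ^ n` are dense in a disc of the projective line, and this disc contains a
rational point. -/
theorem wedge_rowMul_eq_zero_of_reduction_eq_one
    (hV : IsUniformlyIrrational V (Submonoid.powers B)) (hB : reduction p 2 B = 1) :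
    wedge V (rowMul V B) = 0 := by
  by_contra hne
  have hV0 : V ≠ 0 := by
    rintro rfl
    exact hne (by simp [wedge])
  obtain ⟨i, hi⟩ := exists_norm_apply_eq_norm V
  have hnorm (n : ℕ) : ‖rowMul V (B ^ n) i‖ = ‖V‖ :=
    norm_rowMul_apply_of_reduction_eq_one V hi (by rw [map_pow, hB, one_pow])
  have hVpos : 0 < ‖V‖ := norm_pos_iff.mpr hV0
  have hδ : wedge V (rowMul V B) / V i ^ 2 ≠ 0 :=
    div_ne_zero hne (pow_ne_zero 2 (norm_ne_zero_iff.mp (hi ▸ hVpos.ne')))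
  have hchart : ‖chart i V‖ ≤ 1 := by
    rw [chart, norm_div, hi, div_le_one hVpos]
    exact norm_le_pi_norm V _
  obtain ⟨a, ha⟩ := exists_norm_intCast_sub_le hchart hδ
  obtain ⟨v, hv, hdot⟩ := exists_dotProduct_eq_mul_chart_sub (K := ℚ_[p]) i a
  obtain ⟨η, hη, hle⟩ := hV v hv
  have hclosure : (a : ℚ_[p]) ∈ closure (Set.range fun n : ℕ => chart i (rowMul V (B ^ n))) :=
    closedBall_subset_closure_range hδ (norm_chart_rowMul_pow_sub hi hV0 hB)
      (mem_closedBall_iff_norm.mpr (by simpa using ha))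
  obtain ⟨n, hn⟩ := Metric.mem_closure_range_iff.mp hclosure (η / ‖V‖) (by positivity)
  refine (hle _ ⟨n, rfl⟩).not_gt ?_
  rw [dist_comm, dist_eq_norm, lt_div_iff₀ hVpos] at hn
  rw [hdot _ (norm_ne_zero_iff.mp ((hnorm n).symm ▸ hVpos.ne')), norm_mul, hnorm, mul_comm]
  exact hn

theorem wedge_rowMul_eq_zero (hV : IsUniformlyIrrational V (Submonoid.powers A))
    (hA : ∀ n : ℕ, 0 < n → (A ^ n).val 0 1 ≠ 0) : wedge V (rowMul V A) = 0 := by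
  have : NeZero (p ^ 2) := ⟨pow_ne_zero 2 (Fact.out : p.Prime).ne_zero⟩
  set M := orderOf (reduction p 2 A)
  have hB : reduction p 2 (A ^ M) = 1 := by rw [map_pow, pow_orderOf_eq_one]
  have hU : ((lucasU A.val.trace A.val.det M : ℤ) : ℚ_[p]) ≠ 0 :=
    Int.cast_ne_zero.mpr (lucasU_ne_zero_of_pow_apply_ne_zero (hA M (orderOf_pos _)))
  have hpow : IsUniformlyIrrational V (Submonoid.powers (A ^ M)) := by
    have hle : Submonoid.powers (A ^ M) ≤ Submonoid.powers A :=
      Submonoid.powers_le.mpr ⟨M, rfl⟩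
    exact hV.mono_of_reduction_eq fun g hg k => ⟨g, hle hg, rfl⟩
  have h := wedge_rowMul_eq_zero_of_reduction_eq_one hpow hB
  rw [wedge_rowMul_pow] at h
  exact (mul_eq_zero.mp h).resolve_left hU

theorem IsUniformlyIrrational.rowMul_injective (hV : IsUniformlyIrrational V S) (hS : 1 ∈ S) :
    Function.Injective (rowMul V) := by
  intro g h hgh
  ext i j
  by_contra hne
  have hv : (fun i => g.val i j - h.val i j) ≠ 0 :=
    fun h0 => hne (sub_eq_zero.mp (congrFun h0 i))
  obtain ⟨η, hη, hle⟩ := hV _ hv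
  have hzero : V ⬝ᵥ (Int.cast ∘ fun i => g.val i j - h.val i j) = 0 := by
    have hj := sub_eq_zero.mpr (congrFun hgh j)
    simp only [rowMul, vecMul, dotProduct, ← Finset.sum_sub_distrib, ← mul_sub] at hj
    simpa [dotProduct] using hj
  have hle_one := hle 1 hS
  rw [rowMul_one, hzero, norm_zero] at hle_one
  exact hη.not_ge hle_one

theorem IsUniformlyIrrational.commute (hV : IsUniformlyIrrational V S) (hS : 1 ∈ S)
    (hA : wedge V (rowMul V A) = 0) (hB : wedge V (rowMul V B) = 0) : Commute A B := by
  refine hV.rowMul_injective hS ?_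
  obtain rfl | hV0 := eq_or_ne V 0
  · simp [rowMul]
  obtain ⟨a, ha⟩ := exists_eq_smul_of_wedge_eq_zero hV0 hA
  obtain ⟨b, hb⟩ := exists_eq_smul_of_wedge_eq_zero hV0 hB
  have hsmul (c : ℚ_[p]) (g : GL (Fin 2) ℤ) : rowMul (c • V) g = c • rowMul V g :=
    smul_vecMul _ _ _
  rw [rowMul_mul, rowMul_mul, ha, hb, hsmul, hsmul, ha, hb, smul_comm]

end UniformIrrationality

section LMad

theorem extShift_mk (w : ℕ → ℕ) {V : Fin 2 → ℚ_[p]} (hV : V ≠ 0) :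
    extShift p (w, Projectivization.mk ℚ_[p] V hV) =
      (shift w, Projectivization.mk ℚ_[p] (rowMul V (letterMatrix (w 0)))
        (rowMul_ne_zero hV _)) := by
  have hsymm : toPadic (p := p) (letterMatrix (w 0)) • V = rowMul V (letterMatrix (w 0)) := by
    ext i
    fin_cases i <;> simp [letterMatrix, rowMul, vecMul, dotProduct, mul_comm]
  rw [extShift, Projectivization.smul_mk]
  simp only [hsymm]

theorem extShift_iterate_mk (w : ℕ → ℕ) {V : Fin 2 → ℚ_[p]} (hV : V ≠ 0) (n : ℕ) :
    (extShift p)^[n] (w, Projectivization.mk ℚ_[p] V hV) =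
      (shift^[n] w, Projectivization.mk ℚ_[p] (rowMul V (prefixMatrix w n))
        (rowMul_ne_zero hV _)) := by
  induction n with
  | zero => simp [prefixWord, wordMatrix]
  | succ n ih =>
    have hlast : prefixMatrix w (n + 1) =
        prefixMatrix w n * letterMatrix ((shift^[n] w) 0) := by
      rw [prefixMatrix_add]
      simp [prefixWord, wordMatrix]
    simp only [Function.iterate_succ_apply', ih, extShift_mk, hlast, rowMul_mul]

variable {w : ℕ → ℕ} {q : ℙ ℚ_[p] (Fin 2 → ℚ_[p])}

theorem one_le_of_mem_lMad (h : (w, q) ∈ lMad p) (i : ℕ) : 1 ≤ w i := by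
  obtain ⟨ε, -, h⟩ := h
  exact ((h 0).1 i).1

theorem extShift_mem_lMad {x : (ℕ → ℕ) × ℙ ℚ_[p] (Fin 2 → ℚ_[p])} (hx : x ∈ lMad p) :
    extShift p x ∈ lMad p := by
  obtain ⟨ε, hε, h⟩ := hx
  exact ⟨ε, hε, fun n => h (n + 1)⟩

theorem encard_lMad_le_encard_lMad_shift (w : ℕ → ℕ) (n : ℕ) :
    {q | (w, q) ∈ lMad p}.encard ≤ {q | (shift^[n] w, q) ∈ lMad p}.encard := by
  induction n with
  | zero => rfl
  | succ n ih =>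
    rw [Function.iterate_succ_apply']
    exact ih.trans (Set.encard_le_encard_of_injOn (fun q hq => extShift_mem_lMad hq)
      (MulAction.injective (toPadic (letterMatrix ((shift^[n] w) 0)))).injOn)

theorem isUniformlyIrrational_of_mem_lMad (h : (w, q) ∈ lMad p) :
    IsUniformlyIrrational q.rep (Set.range (prefixMatrix w)) := by
  obtain ⟨ε, hε, h⟩ := h
  intro v hv
  have hv' : (v 0, v 1) ≠ (0, 0) := by
    intro h0
    rw [Prod.mk.injEq] at h0
    exact hv (by ext i; fin_cases i; exacts [h0.1, h0.2])
  have hmax : 0 < max (|(v 0 : ℝ)| ^ 2) (|(v 1 : ℝ)| ^ 2) := by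
    obtain ⟨i, hi⟩ := Function.ne_iff.mp hv
    have hpos : 0 < |(v i : ℝ)| ^ 2 := pow_pos (abs_pos.mpr (Int.cast_ne_zero.mpr hi)) 2
    fin_cases i
    exacts [lt_max_of_lt_left hpos, lt_max_of_lt_right hpos]
  have hq : 0 < ‖q.rep‖ := norm_pos_iff.mpr q.rep_nonzero
  refine ⟨(max (|(v 0 : ℝ)| ^ 2) (|(v 1 : ℝ)| ^ 2))⁻¹ * ε * ‖q.rep‖, by positivity, ?_⟩
  rintro _ ⟨n, rfl⟩
  have hn := (h n).2
  rw [← q.mk_rep, extShift_iterate_mk, mk_mem_pBad] at hn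
  have hform := hn (v 0) (v 1) hv'
  rw [← norm_eq_max, norm_rowMul, ← div_eq_mul_inv, le_div_iff₀ hq] at hform
  simpa [dotProduct, mul_comm] using hform

theorem mem_leftEigenpoints_of_mem_returnTimes {m : ℕ} (hm : m ∈ returnTimes p w) (hpos : 0 < m)
    (h : (w, q) ∈ lMad p) : q ∈ leftEigenpoints (toPadic (prefixMatrix w m)).val := by
  exact wedge_rowMul_eq_zero ((isUniformlyIrrational_of_mem_lMad h).mono_of_reduction_eq
    (exists_reduction_eq_of_mem_returnTimes hm)) fun n hn =>
      (prefixMatrix_pow_apply_zero_one_pos (one_le_of_mem_lMad h) hpos hn).ne'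

theorem encard_lMad_le_two {m : ℕ} (hm : m ∈ returnTimes p w) (hpos : 0 < m) :
    {q | (w, q) ∈ lMad p}.encard ≤ 2 := by
  obtain hempty | ⟨r, hr⟩ := {q | (w, q) ∈ lMad p}.eq_empty_or_nonempty
  · simp [hempty]
  have hentry : (toPadic (p := p) (prefixMatrix w m)).val 0 1 ≠ 0 := by
    have hpow := prefixMatrix_pow_apply_zero_one_pos (one_le_of_mem_lMad hr) hpos one_pos
    rw [pow_one] at hpow
    exact Int.cast_ne_zero.mpr hpow.ne'
  exact (Set.encard_le_encard fun q hq => mem_leftEigenpoints_of_mem_returnTimes hm hpos hq).trans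
    (encard_leftEigenpoints_le_two hentry)

theorem isPeriodic_of_mem_lMad (hinf : (returnTimes p w).Infinite) (h : (w, q) ∈ lMad p) :
    IsPeriodic w := by
  obtain ⟨l, hl, hlpos⟩ := hinf.exists_gt 0
  refine ⟨l, hlpos, funext fun i => ?_⟩
  obtain ⟨m, hm, hlt⟩ := hinf.exists_gt (i + l)
  rw [shift_iterate_apply]
  refine apply_add_eq_of_commute (one_le_of_mem_lMad h) ?_ hlt
  have h_one : 1 ∈ Set.range (prefixMatrix w) := ⟨0, by simp [prefixWord, wordMatrix]⟩
  exact (isUniformlyIrrational_of_mem_lMad h).commute h_one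
    (mem_leftEigenpoints_of_mem_returnTimes hl hlpos h)
    (mem_leftEigenpoints_of_mem_returnTimes hm (by omega) h)

end LMad

end LimitMad

theorem proposition8p2_general (p : ℕ) [Fact p.Prime] (w : ℕ → ℕ)
    (hbdd : ∃ C : ℕ, ∀ k : ℕ, 1 ≤ k → (LimitMad.residueCollection p k w).encard ≤ C) :
    {q : ℙ ℚ_[p] (Fin 2 → ℚ_[p]) | (w, q) ∈ LimitMad.lMad p}.encard ≤ 2 ∧
      ((∀ n, ¬ LimitMad.IsPeriodic (LimitMad.shift^[n] w)) →
        ∀ q : ℙ ℚ_[p] (Fin 2 → ℚ_[p]), (w, q) ∉ LimitMad.lMad p) := by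
  obtain ⟨n, hn⟩ := LimitMad.exists_infinite_returnTimes hbdd
  have hshift := LimitMad.encard_lMad_le_encard_lMad_shift (p := p) w n
  refine ⟨?_, fun hper q hq => ?_⟩
  · obtain ⟨m, hm, hpos⟩ := hn.exists_gt 0
    exact hshift.trans (LimitMad.encard_lMad_le_two hm hpos)
  · obtain ⟨r, hr⟩ := Set.encard_pos.mp ((Set.encard_pos.mpr ⟨q, hq⟩).trans_le hshift)
    exact hper n (LimitMad.isPeriodic_of_mem_lMad hn hr)

theorem proposition8p2 (p : ℕ) [Fact p.Prime] (N : ℕ) (w : ℕ → ℕ)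
    (hw : ∀ i, w i ∈ LimitMad.alphabet N)
    (hrec : LimitMad.IsRecurrent w)
    (hbdd : ∃ C : ℕ, ∀ k : ℕ, 1 ≤ k → (LimitMad.residueCollection p k w).encard ≤ C) :
    {q : ℙ ℚ_[p] (Fin 2 → ℚ_[p]) | (w, q) ∈ LimitMad.lMad p}.encard ≤ 2 ∧
      (¬ LimitMad.IsPeriodic w →
        ∀ q : ℙ ℚ_[p] (Fin 2 → ℚ_[p]), (w, q) ∉ LimitMad.lMad p) :=
  (proposition8p2_general p w hbdd).imp_right fun h hper =>
    h fun _ hn => hper (hrec.isPeriodic_of_shift hn)
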